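/- **Setting.** $\mathbb N$ is the set of positive integers, $\mathbb Z_+=\mathbb N\cup\{0\}$, and $FIN(\mathbb N)$ is the additive monoid of finitely supported $\mathbf m:\mathbb N\to\mathbb Z_+$ with the pointwise order. A *label* is a set $\mathcal M\subset FIN(\mathbb N)$ such that $\mathbf m\in\mathcal M$ and $\mathbf m'\le\mathbf m$ imply $\mathbf m'\in\mathcal M$. The space of labels has the topology in which $\mathcal M^i\to\mathcal M$ iff each $\mathbf m\in\mathcal M$ is eventually in $\mathcal M^i$ and each $\mathbf m\notin\mathcal M$ is eventually not in $\mathcal M^i$ (the topology of the ultrametric $d(\mathcal M_1,\mathcal M_2)=\inf\{2^{-N}:\mathcal M_1\cap\mathcal B_N=\mathcal M_2\cap\mathcal B_N\}$, where $\mathcal B_N$ is the set of vectors with entries at most $N$ and support in $[1,N]$). For $\mathbf r\in FIN(\mathbb N)$ let $P_{\mathbf r}(\mathcal M)=\mathcal M-\mathbf r=\{\mathbf w:\mathbf w+\mathbf r\in\mathcal M\}$; this is a continuous action of $FIN(\mathbb N)$. $\Theta(\mathcal M)$ is the closure of $\{\mathcal M-\mathbf r:\mathbf r\in FIN(\mathbb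 N)\}$. The label $\mathcal M$ is *finitary* if there is $\mu:\mathbb N\to\mathbb Z_+$ with $\mathbf m\le\mu$ for all $\mathbf m\in\mathcal M$, and for every sequence $\{S_i\}$ of finite subsets of $\mathbb N$ with $\bigcup_i S_i$ infinite there are only finitely many $T\subset\mathbb N$ such that, for all large $i$, $T\cup S_i$ is the support of an element of $\mathcal M$. An *external limit set* of $\mathcal M$ is a limit of a sequence $\{\mathcal M-\mathbf r^i\}$ with $\{\mathbf r^i\}$ a sequence of distinct elements of $\mathcal M$. Fix an integer $b\ge 3$ and an odd function $k:\mathbb Z\to\mathbb Z$ with $k(n+1)>b\sum_{i=0}^n k(i)$ for all $n\ge 0$ and $k(1)\ge b+1$ (e.g. $b=3$ and $k(n)=\operatorname{sgn}(n)4^{|n|}$), and a partition $\{D_\ell\}_{\ell\in\mathbb N}$ of $\mathbb N$ into infinite sets with $\min D_\ell<\min D_{\ell+1}$; write $n\in D_{\ell(n)}$. An expansion of $t\in\mathbb Z$ is a finite (possibly empty) sequence of nonzero integers $j_1,\dots,j_r$ with $|j_1|>\dots>|j_r|$ and $t=k(j_1)+\dots+k(j_r)$; its length vector is $\sum_i\chi(\ell(|j_i|))$,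 where $\chi(\ell)$ is the unit vector at $\ell$ (an integer has at most one expansion). $A[\mathcal M]$ is the set of integers that have an expansion with length vector in $\mathcal M$, and $A_+[\mathcal M]$ is its intersection with the set $IP_+(k)$ of sums of finite subsets of $k(\mathbb Z_+)$. Let $x[\mathcal M],x_+[\mathcal M]\in\{0,1\}^{\mathbb Z}$ be the characteristic functions of $A[\mathcal M],A_+[\mathcal M]$, and $X(\mathcal M),X_+(\mathcal M)$ their orbit closures under the shift $S(x)_t=x_{t+1}$. The enveloping semigroup of a continuous action of a monoid on a compact space $Y$ is the closure, in $Y^Y$ with the topology of pointwise convergence, of the set of maps by which the monoid acts, with composition. $\mathcal E(\Theta(\mathcal M))$ is that of the action of $FIN(\mathbb N)$ on $\Theta(\mathcal M)$, and $E(X,S)$ that of the action of $\mathbb Z$ on a subshift $X$ by powers of $S$. $(X,S)$ is WAP if every element of $E(X,S)$ is continuous. **Theorem.** Let $\mathcal M$ be a finitary label. 1. $(X(\mathcal M),S)$ and $(X_+(\mathcal M),S)$ are countable WAP subshifts. 2. For all $\mathcal N\in\Theta(\mathcal M)$ we have $x[\mathcal N]\in X(\mathcal M)$ and $x_+[\mathcal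 N]\in X_+(\mathcal M)$, and there are unique homomorphisms $J_{\mathcal M}:\mathcal E(\Theta(\mathcal M))\to E(X(\mathcal M),S)$ and $J_{+\mathcal M}:\mathcal E(\Theta(\mathcal M))\to E(X_+(\mathcal M),S)$ with $J_{\mathcal M}(Q)\,x[\mathcal N]=x[Q(\mathcal N)]$ and $J_{+\mathcal M}(Q)\,x_+[\mathcal N]=x_+[Q(\mathcal N)]$ for all $Q\in\mathcal E(\Theta(\mathcal M))$ and $\mathcal N\in\Theta(\mathcal M)$. For each external limit set $\mathcal F$ of $\mathcal M$ there are a unique $q_{\mathcal F}\in E(X(\mathcal M),S)$ with $q_{\mathcal F}x[\mathcal M]=x[\mathcal F]$, a unique $q^+_{\mathcal F}\in E(X_+(\mathcal M),S)$ with $q^+_{\mathcal F}x_+[\mathcal M]=x_+[\mathcal F]$, and a unique $Q_{\mathcal F}\in\mathcal E(\Theta(\mathcal M))$ with $Q_{\mathcal F}(\mathcal M)=\mathcal F$; moreover $q_{\mathcal F}=J_{\mathcal M}(Q_{\mathcal F})$ and $q^+_{\mathcal F}=J_{+\mathcal M}(Q_{\mathcal F})$. 3. The semigroups $\mathcal E(\Theta(\mathcal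 M))$, $E(X(\mathcal M),S)$ and $E(X_+(\mathcal M),S)$ are abelian, and each of their elements is a continuous map of $\Theta(\mathcal M)$, $X(\mathcal M)$ and $X_+(\mathcal M)$, respectively. -/

import Mathlib

open Set Filter Topology

namespace LabelShift

/-! ### Enveloping semigroups -/

section Enveloping

variable (Γ X : Type*) [AddMonoid Γ] [TopologicalSpace X] [AddAction Γ X]
  [ContinuousConstVAdd Γ X]

/-- The closure, in `X → X` with the topology of pointwise convergence, of the set of maps
`x ↦ g +ᵥ x`. -/
def envelopingSet : Set (X → X) := closure (Set.range fun (g : Γ) (x : X) => g +ᵥ x)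

/-- The enveloping semigroup of a continuous action of a monoid `Γ` on `X`: the closure of the set
of maps `x ↦ g +ᵥ x`, which is a monoid under composition of maps. -/
def envelopingSemigroup : Submonoid (Function.End X) where
  carrier := envelopingSet Γ X
  one_mem' := subset_closure (X := X → X) ⟨0, by funext x; exact zero_vadd Γ x⟩
  mul_mem' := by
    intro p q hp hq
    have h1 : ∀ g : Γ, (fun x : X => g +ᵥ (q : X → X) x) ∈ envelopingSet Γ X := by
      intro g
      have hc : Continuous fun (f : X → X) (x : X) => g +ᵥ f x :=
        continuous_pi fun x => (continuous_apply x).const_vadd g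
      refine map_mem_closure (X := X → X) hc hq ?_
      rintro _ ⟨g', rfl⟩
      exact ⟨g + g', by funext x; exact add_vadd g g' x⟩
    have hc : Continuous fun (f : X → X) (x : X) => f ((q : X → X) x) :=
      continuous_pi fun x => continuous_apply _
    have h2 := map_mem_closure (X := X → X) hc hp (t := envelopingSet Γ X)
      (by rintro _ ⟨g, rfl⟩; exact h1 g)
    unfold envelopingSet at h2
    rwa [closure_closure] at h2

/-- Every element of the enveloping semigroup is a continuous map of `X`. -/
def ActsContinuously : Prop :=
  ∀ p ∈ envelopingSemigroup Γ X, Continuous (p : X → X)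

/-- The enveloping semigroup is abelian. -/
def HasAbelianEnveloping : Prop :=
  ∀ p ∈ envelopingSemigroup Γ X, ∀ q ∈ envelopingSemigroup Γ X, p * q = q * p

end Enveloping

/-- A system `(X, T)`, given as an action of `ℤ` (`n` acts as `T ^ n`), is weakly almost periodic
when all elements of its enveloping semigroup are continuous. -/
def IsWAP (X : Type*) [TopologicalSpace X] [AddAction ℤ X] [ContinuousConstVAdd ℤ X] : Prop :=
  ∀ p ∈ envelopingSemigroup ℤ X, Continuous (p : X → X)

/-! ### Labels -/

/-- The additive monoid of finitely supported vectors `m : ℕ → ℤ₊`, where `ℕ` is the set of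
positive integers, with the pointwise order. -/
abbrev FIN : Type := ℕ+ →₀ ℕ

/-- A label is a set of vectors in `FIN` which contains with `m` every `m' ≤ m`. -/
@[ext]
structure Label where
  carrier : Set FIN
  heredity : ∀ m ∈ carrier, ∀ m' ≤ m, m' ∈ carrier

namespace Label

instance : Membership FIN Label := ⟨fun M m => m ∈ M.carrier⟩

/-- The label `M - r = {w : w + r ∈ M}`. -/
def sub (M : Label) (r : FIN) : Label where
  carrier := {w | w + r ∈ M.carrier}
  heredity := fun _ hm _ h => M.heredity _ hm _ (by gcongr)

/-- The indicator of membership of each vector. -/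
noncomputable def indicator (M : Label) : FIN → Bool :=
  open Classical in fun m => decide (m ∈ M)

/-- The topology of the space of labels: a net `M i` converges to `M` when each vector `m ∈ M` is
eventually in `M i` and each vector `m ∉ M` is eventually not in `M i`. It is the topology of the
ultrametric considered in `isOpen_iff_ball`. -/
noncomputable instance : TopologicalSpace Label := TopologicalSpace.induced indicator inferInstance

/-- The vectors with entries at most `N` and support in `[1, N]`. -/
def box (N : ℕ) : Set FIN := {m | ∀ l, m l ≤ N ∧ (m l ≠ 0 → (l : ℕ) ≤ N)}

theorem box_finite (N : ℕ) : (box N).Finite := by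
  have hS : {l : ℕ+ | (l : ℕ) ≤ N}.Finite :=
    (Set.finite_Iic N).preimage (fun _ _ _ _ h => PNat.coe_injective h)
  refine (Set.finite_Iic (∑ l ∈ hS.toFinset, Finsupp.single l N)).subset ?_
  intro m hm l
  rw [Finsupp.finsetSum_apply]
  by_cases hl : m l = 0
  · simp [hl]
  · have hlS : l ∈ hS.toFinset := by simpa using (hm l).2 hl
    calc m l ≤ (Finsupp.single l N : FIN) l := by simpa using (hm l).1
      _ ≤ _ := Finset.single_le_sum (f := fun i => (Finsupp.single i N : FIN) l)
          (fun _ _ => Nat.zero_le _) hlS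

theorem mem_box (m : FIN) : ∃ N, m ∈ box N := by
  refine ⟨(∑ l ∈ m.support, m l) + ∑ l ∈ m.support, (l : ℕ), fun l => ?_⟩
  by_cases hl : m l = 0
  · simp [hl]
  · have h : l ∈ m.support := by simpa using hl
    have h1 := Finset.single_le_sum (f := fun i => m i) (fun _ _ => Nat.zero_le _) h
    have h2 := Finset.single_le_sum (f := fun i : ℕ+ => (i : ℕ)) (fun _ _ => Nat.zero_le _) h
    exact ⟨by omega, fun _ => by omega⟩

theorem box_mono {N N' : ℕ} (h : N ≤ N') : box N ⊆ box N' :=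
  fun _ hm l => ⟨(hm l).1.trans h, fun h0 => ((hm l).2 h0).trans h⟩

theorem isOpen_mem_iff (m : FIN) (P : Prop) : IsOpen {M : Label | m ∈ M ↔ P} := by
  classical
  have hc : Continuous fun f : FIN → Bool => f m := continuous_apply m
  refine isOpen_induced_iff.2 ⟨(fun f : FIN → Bool => f m) ⁻¹' {decide P},
    (isOpen_discrete _).preimage hc, ?_⟩
  ext M
  simp [indicator]

/-- A set of labels is open iff with each label `M` it contains, for some `N`, the ball of all
labels which agree with `M` on `box N`. -/
theorem isOpen_iff_ball (U : Set Label) :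
    IsOpen U ↔ ∀ M ∈ U, ∃ N, {M' : Label | ∀ m ∈ box N, (m ∈ M' ↔ m ∈ M)} ⊆ U := by
  constructor
  · rintro hU M hM
    obtain ⟨V, hV, rfl⟩ := isOpen_induced_iff.1 hU
    obtain ⟨I, u, hu, hsub⟩ := isOpen_pi_iff.1 hV _ hM
    choose n hn using mem_box
    refine ⟨I.sup n, fun M' hM' => hsub fun m hm => ?_⟩
    have h := hM' m (box_mono (Finset.le_sup (f := n) hm) (hn m))
    have h' : indicator M' m = indicator M m := by simp [indicator, h]
    rw [h']
    exact (hu m hm).2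
  · intro h
    refine isOpen_iff_forall_mem_open.2 fun M hM => ?_
    obtain ⟨N, hN⟩ := h M hM
    refine ⟨_, hN, ?_, fun m _ => Iff.rfl⟩
    have : {M' : Label | ∀ m ∈ box N, (m ∈ M' ↔ m ∈ M)} =
        ⋂ m ∈ box N, {M' : Label | m ∈ M' ↔ m ∈ M} := by
      ext; simp
    rw [this]
    exact (box_finite N).isOpen_biInter fun m _ => isOpen_mem_iff m _

theorem continuous_sub (r : FIN) : Continuous fun M : Label => M.sub r := by
  refine continuous_induced_rng.2 (continuous_pi fun m => ?_)
  have hc : Continuous fun f : FIN → Bool => f (m + r) := continuous_apply (m + r)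
  exact hc.comp (continuous_induced_dom (f := indicator))

/-- There is `μ` with `m ≤ μ` for all `m ∈ M`. -/
def IsBounded (M : Label) : Prop := ∃ μ : ℕ+ → ℕ, ∀ m ∈ M, ∀ l, m l ≤ μ l

/-- The set of supports of the vectors in `M`. -/
def Supp (M : Label) : Set (Finset ℕ+) := {S | ∃ m ∈ M, m.support = S}

/-- A bounded label is finitary when, for each sequence `S i` of finite sets with infinite union,
there are only finitely many sets `T` with `T ∪ S i ∈ Supp M` for all large `i` (such a `T` is
necessarily finite). -/
def IsFinitary (M : Label) : Prop :=
  M.IsBounded ∧ ∀ S : ℕ → Finset ℕ+, (⋃ i, (S i : Set ℕ+)).Infinite →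
    {T : Finset ℕ+ | ∀ᶠ i in atTop, T ∪ S i ∈ M.Supp}.Finite

/-- `F` is an external limit set for `M`: the limit of a sequence `M - r i`, for a sequence `r` of
distinct vectors in `M`. -/
def IsExternalLimitSet (M F : Label) : Prop :=
  ∃ r : ℕ → FIN, Function.Injective r ∧ (∀ i, r i ∈ M) ∧
    Tendsto (fun i => M.sub (r i)) atTop (𝓝 F)

/-- The orbit closure `Θ(M)` of `M` under the maps `P_r : N ↦ N - r`, `r ∈ FIN`. -/
def Theta (M : Label) : Set Label := closure (Set.range fun r : FIN => M.sub r)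

theorem sub_mem_Theta {M N : Label} (r : FIN) (h : N ∈ M.Theta) : N.sub r ∈ M.Theta := by
  refine map_mem_closure (f := fun N : Label => N.sub r) (continuous_sub r) h ?_
  rintro _ ⟨s, rfl⟩
  exact ⟨r + s, Label.ext (by simp [sub, add_assoc])⟩

/-- The action of `FIN` on `Θ(M)`: the vector `r` acts as `P_r : N ↦ N - r`. -/
instance (M : Label) : AddAction FIN M.Theta where
  vadd r N := ⟨N.1.sub r, sub_mem_Theta r N.2⟩
  zero_vadd N := Subtype.ext (Label.ext (Set.ext fun w => by
    change w + 0 ∈ N.1.carrier ↔ _; rw [add_zero]))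
  add_vadd r s N := Subtype.ext (Label.ext (Set.ext fun w => by
    change w + (r + s) ∈ N.1.carrier ↔ w + r + s ∈ N.1.carrier; rw [add_assoc]))

instance (M : Label) : ContinuousConstVAdd FIN M.Theta where
  continuous_const_vadd r :=
    ((continuous_sub r).comp continuous_subtype_val).subtype_mk _

/-- `M` as a point of `Θ(M)`. -/
def toTheta (M : Label) : M.Theta := ⟨M, subset_closure ⟨0, by ext w; simp [sub]⟩⟩

end Label

/-! ### Subshifts -/

/-- The `n`-th power of the shift `S` on `{0,1}^ℤ`, `S(x)_t = x_{t+1}`. -/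
def shift (n : ℤ) (x : ℤ → Bool) : ℤ → Bool := fun t => x (t + n)

theorem continuous_shift (n : ℤ) : Continuous (shift n) :=
  continuous_pi fun t => continuous_apply (t + n)

/-- A subshift: a closed, shift invariant subset of `{0,1}^ℤ`. -/
def IsSubshift (Y : Set (ℤ → Bool)) : Prop := IsClosed Y ∧ shift 1 '' Y = Y

/-- The orbit closure of `x` under the shift. -/
def orbitClosure (x : ℤ → Bool) : Set (ℤ → Bool) := closure (Set.range fun n : ℤ => shift n x)

theorem shift_mem_orbitClosure {x y : ℤ → Bool} (n : ℤ) (h : y ∈ orbitClosure x) :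
    shift n y ∈ orbitClosure x := by
  refine map_mem_closure (continuous_shift n) h ?_
  rintro _ ⟨s, rfl⟩
  exact ⟨n + s, by funext t; simp [shift, add_assoc]⟩

/-- The action of `ℤ` on an orbit closure: `n` acts as the `n`-th power of the shift. -/
instance (x : ℤ → Bool) : AddAction ℤ (orbitClosure x) where
  vadd n y := ⟨shift n y.1, shift_mem_orbitClosure n y.2⟩
  zero_vadd y := Subtype.ext (by funext t; change y.1 (t + 0) = _; rw [add_zero])
  add_vadd m n y := Subtype.ext (by
    funext t; change y.1 (t + (m + n)) = y.1 (t + m + n); rw [add_assoc])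

instance (x : ℤ → Bool) : ContinuousConstVAdd ℤ (orbitClosure x) where
  continuous_const_vadd n :=
    ((continuous_shift n).comp continuous_subtype_val).subtype_mk _

/-- `x` as a point of its orbit closure. -/
def basePoint (x : ℤ → Bool) : orbitClosure x :=
  ⟨x, subset_closure ⟨0, by funext t; simp [shift]⟩⟩

/-! ### Expanding times -/

/-- `k : ℤ → ℤ` is `b`-expanding: it is odd and `k (n + 1) > b * (k 0 + ⋯ + k n)` for `n ≥ 0`. -/
def IsExpandingFunction (b : ℕ) (k : ℤ → ℤ) : Prop :=
  (∀ n, k (-n) = -k n) ∧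
    ∀ n : ℕ, (b : ℤ) * ∑ i ∈ Finset.range (n + 1), k (i : ℤ) < k ((n : ℤ) + 1)

/-- A partition `D 1, D 2, …` of the positive integers into infinite sets, with
`min (D l) < min (D (l + 1))`, given by the map `ell` with `n ∈ D (ell n)`. -/
def IsSupportMap (ell : ℕ+ → ℕ+) : Prop :=
  (∀ l, (ell ⁻¹' {l}).Infinite) ∧
    ∀ l m n, IsLeast (ell ⁻¹' {l}) m → IsLeast (ell ⁻¹' {l + 1}) n → m < n

/-- The finite sequence `j` is an expansion of `t`: the `j i` are nonzero with strictly decreasing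
absolute values, and `t = k (j 1) + ⋯ + k (j r)`. -/
def IsExpansion (k : ℤ → ℤ) (t : ℤ) (j : List ℤ) : Prop :=
  j.Pairwise (fun a c => |c| < |a|) ∧ (∀ a ∈ j, a ≠ 0) ∧ t = (j.map k).sum

/-- The length vector `χ(ell |j 1|) + ⋯ + χ(ell |j r|)` of the expansion `j`. -/
noncomputable def lengthVector (ell : ℕ+ → ℕ+) (j : List ℤ) : FIN :=
  (j.map fun a => Finsupp.single (ell a.natAbs.toPNat') 1).sum

/-- `A[M]`: the integers which have an expansion whose length vector is in `M`. -/
def timeSet (k : ℤ → ℤ) (ell : ℕ+ → ℕ+) (M : Label) : Set ℤ :=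
  {t | ∃ j, IsExpansion k t j ∧ lengthVector ell j ∈ M}

/-- `IP₊(k)`: the sums of finite subsets of `{k n : n ≥ 0}`. -/
def posIP (k : ℤ → ℤ) : Set ℤ :=
  {t | ∃ F : Finset ℤ, (F : Set ℤ) ⊆ k '' {n | 0 ≤ n} ∧ t = ∑ a ∈ F, a}

/-- The characteristic function of a set of integers, as a point of `{0,1}^ℤ`. -/
noncomputable def chi (A : Set ℤ) : ℤ → Bool := open Classical in fun t => decide (t ∈ A)

/-- The point `x[M]`, the characteristic function of `A[M]`. -/
noncomputable def xOf (k : ℤ → ℤ) (ell : ℕ+ → ℕ+) (M : Label) : ℤ → Bool :=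
  chi (timeSet k ell M)

/-- The point `x₊[M]`, the characteristic function of `A₊[M] = A[M] ∩ IP₊(k)`. -/
noncomputable def xPosOf (k : ℤ → ℤ) (ell : ℕ+ → ℕ+) (M : Label) : ℤ → Bool :=
  chi (timeSet k ell M ∩ posIP k)

/-- The subshift `X(M)`, the orbit closure of `x[M]`. -/
abbrev XOf (k : ℤ → ℤ) (ell : ℕ+ → ℕ+) (M : Label) : Set (ℤ → Bool) := orbitClosure (xOf k ell M)

/-- The subshift `X₊(M)`, the orbit closure of `x₊[M]`. -/
abbrev XPosOf (k : ℤ → ℤ) (ell : ℕ+ → ℕ+) (M : Label) : Set (ℤ → Bool) :=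
  orbitClosure (xPosOf k ell M)

/-- For a map `y` from labels to points of `{0,1}^ℤ` (below `x[·]` or `x₊[·]`), the homomorphism `J`
from the enveloping semigroup of `Θ(M)` to that of the orbit closure of `y M` is induced by `y`:
for all `Q` and all `N ∈ Θ(M)`, the point `y N` is in the orbit closure of `y M` and
`J Q` maps it to `y (Q N)`. -/
def IsInduced (y : Label → ℤ → Bool) (M : Label)
    (J : envelopingSemigroup FIN M.Theta →* envelopingSemigroup ℤ (orbitClosure (y M))) : Prop :=
  ∀ (Q : envelopingSemigroup FIN M.Theta) (N : M.Theta),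
    ∃ h : y N ∈ orbitClosure (y M),
      ((J Q).1 (⟨y N, h⟩ : orbitClosure (y M)) : orbitClosure (y M)).1 = y (Q.1 N : M.Theta).1

end LabelShift

open LabelShift

/-! If the orbit of x₀ is dense, evaluation at x₀ maps the enveloping semigroup onto the space. When
the semigroup is abelian, this gives both continuity of its elements and the fact that each is
determined by its value at x₀. So the theorem reduces to commutativity at the base points and to a
dictionary between the semigroups of Θ(M) and of the orbit closures. Elements of an enveloping
semigroup are handled as limits along ultrafilters of acting maps.

On Θ(M), finitariness says that along a nonprincipal ultrafilter only finitely many m satisfy m + s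
∈ M for most s (`IsFinitary.finite_setOf_eventually`). Hence two nonprincipal limits applied in
succession to M give the empty label in either order, while a principal one commutes with
everything.

For the subshifts, fast growth of k makes two expansions agree on all entries larger than the
difference of their sums. So adding to s the sum of an expansion e with entries beyond |s| changes
membership in A[N] into membership of s in A[N - r], where r is the length vector of e
(`add_sum_mem_timesOf_iff`). Shifts by such sums, with entries tending to infinity, converge to P_r
on all points x[N] at once. Conversely, let shifts converge along an ultrafilter. Either x[M], and
with it every x[N], goes to zero, or after a translation most times lie in A[M]. In the second case
the entries common to most of their expansions form a finite set, again by finitariness, and the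
remaining entries escape to infinity. The limit is then a shift of a map coming from Θ(M), so
commutativity and countability carry over. A predicate P on entries treats x[·] and x₊[·] together.
-/

namespace LabelShift

/-! ### Enveloping semigroups of systems with a dense orbit -/

section EnvelopingLemmas

variable {Γ X : Type*} [AddMonoid Γ] [TopologicalSpace X] [AddAction Γ X]

theorem exists_ultrafilter_of_mem_envelopingSet {p : X → X} (hp : p ∈ envelopingSet Γ X) :
    ∃ U : Ultrafilter Γ, ∀ x, Tendsto (fun g : Γ => g +ᵥ x) U (𝓝 (p x)) := by
  let f : Γ → X → X := fun g x => g +ᵥ x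
  have hne : (comap f (𝓝 p)).NeBot := by
    refine comap_neBot fun t ht => ?_
    obtain ⟨_, hy, g, rfl⟩ := mem_closure_iff_nhds.1 hp t ht
    exact ⟨g, hy⟩
  refine ⟨Ultrafilter.of (comap f (𝓝 p)), ?_⟩
  have h : Tendsto f (Ultrafilter.of (comap f (𝓝 p))) (𝓝 p) :=
    tendsto_comap.mono_left (Ultrafilter.of_le _)
  exact fun x => tendsto_pi_nhds.1 h x

/-- The maps are allowed to be limits themselves, so that limits of limits are covered. -/
theorem exists_mem_envelopingSet_of_ultrafilter [CompactSpace X] {ι : Type*}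
    (U : Ultrafilter ι) (f : ι → X → X) (hf : ∀ i, f i ∈ envelopingSet Γ X) :
    ∃ p ∈ envelopingSet Γ X, ∀ x, Tendsto (fun i => f i x) U (𝓝 (p x)) := by
  have hc : IsCompact (envelopingSet Γ X) := isClosed_closure.isCompact
  obtain ⟨p, hp, hlim⟩ := hc.ultrafilter_le_nhds' (U.map f)
    (Filter.Eventually.of_forall (f := (U : Filter ι)) hf)
  exact ⟨p, hp, fun x => tendsto_pi_nhds.1 (show Tendsto f U (𝓝 p) from hlim) x⟩

variable [ContinuousConstVAdd Γ X]

theorem vadd_mem_envelopingSemigroup (g : Γ) :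
    (fun x : X => g +ᵥ x : Function.End X) ∈ envelopingSemigroup Γ X :=
  subset_closure (X := X → X) ⟨g, rfl⟩

variable [CompactSpace X] [T2Space X]

theorem exists_apply_eq_of_dense {x₀ : X} (hx : Dense (range fun g : Γ => g +ᵥ x₀)) (z : X) :
    ∃ p ∈ envelopingSemigroup Γ X, p x₀ = z := by
  have hc : IsCompact (envelopingSet Γ X) := isClosed_closure.isCompact
  have hcl : IsClosed ((fun p : X → X => p x₀) '' envelopingSet Γ X) :=
    (hc.image (continuous_apply x₀)).isClosed
  have hsub : range (fun g : Γ => g +ᵥ x₀) ⊆ (fun p : X → X => p x₀) '' envelopingSet Γ X := by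
    rintro _ ⟨g, rfl⟩
    exact ⟨_, vadd_mem_envelopingSemigroup g, rfl⟩
  obtain ⟨p, hp, h⟩ := closure_minimal hsub hcl (hx z)
  exact ⟨p, hp, h⟩

/-- Any point is r x₀ with r in the semigroup. The hypothesis is used for the pair q, r and then for
the pair p r, q. -/
theorem hasAbelianEnveloping_of_dense {x₀ : X} (hx : Dense (range fun g : Γ => g +ᵥ x₀))
    (h : ∀ p ∈ envelopingSemigroup Γ X, ∀ q ∈ envelopingSemigroup Γ X, p (q x₀) = q (p x₀)) :
    HasAbelianEnveloping Γ X := by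
  intro p hp q hq
  funext y
  obtain ⟨r, hr, rfl⟩ := exists_apply_eq_of_dense hx y
  change p (q (r x₀)) = q (p (r x₀))
  rw [h q hq r hr]
  exact h _ (mul_mem hp hr) q hq

theorem eq_of_apply_eq_of_dense {x₀ : X} (hx : Dense (range fun g : Γ => g +ᵥ x₀))
    (h : HasAbelianEnveloping Γ X) {p q : Function.End X} (hp : p ∈ envelopingSemigroup Γ X)
    (hq : q ∈ envelopingSemigroup Γ X) (hpq : p x₀ = q x₀) : p = q := by
  funext y
  obtain ⟨r, hr, rfl⟩ := exists_apply_eq_of_dense hx y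
  have h1 : p (r x₀) = r (p x₀) := congrFun (h p hp r hr) x₀
  have h2 : q (r x₀) = r (q x₀) := congrFun (h q hq r hr) x₀
  rw [h1, h2, hpq]

/-- Evaluation at x₀ is a quotient map from the compact semigroup onto X. By commutativity, p
composed with it is evaluation at p x₀, which is continuous. -/
theorem actsContinuously_of_dense {x₀ : X} (hx : Dense (range fun g : Γ => g +ᵥ x₀))
    (h : HasAbelianEnveloping Γ X) : ActsContinuously Γ X := by
  intro p hp
  have : CompactSpace (envelopingSet Γ X) :=
    isCompact_iff_compactSpace.1 isClosed_closure.isCompact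
  let ev : X → envelopingSet Γ X → X := fun x q => q.1 x
  have hev : ∀ x, Continuous (ev x) := fun x =>
    (continuous_apply x).comp continuous_subtype_val
  have hsurj : Function.Surjective (ev x₀) := fun z => by
    obtain ⟨q, hq, hz⟩ := exists_apply_eq_of_dense hx z
    exact ⟨⟨q, hq⟩, hz⟩
  have hquot : IsQuotientMap (ev x₀) := (hev x₀).isClosedMap.isQuotientMap (hev x₀) hsurj
  refine hquot.continuous_iff.2 ?_
  have : (p : X → X) ∘ ev x₀ = ev (p x₀) := by
    funext q
    exact congrFun (h p hp q.1 q.2) x₀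
  rw [this]
  exact hev _

end EnvelopingLemmas

/-! ### The space of labels -/

namespace Label

theorem tendsto_iff {ι : Type*} {f : ι → Label} {F : Filter ι} {N : Label} :
    Tendsto f F (𝓝 N) ↔ ∀ m, ∀ᶠ i in F, (m ∈ f i ↔ m ∈ N) := by
  rw [nhds_induced, tendsto_comap_iff, tendsto_pi_nhds]
  refine forall_congr' fun m => ?_
  rw [nhds_discrete, tendsto_pure]
  simp [indicator]

theorem indicator_injective : Function.Injective indicator := by
  intro M N h
  refine Label.ext (Set.ext fun m => ?_)
  have := congrFun h m
  simp only [indicator, decide_eq_decide] at this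
  exact this

/-- Heredity is a closed condition on indicators, which yields compactness of the space of labels.
-/
theorem range_indicator :
    range indicator = {f | ∀ m, ∀ m' ≤ m, f m = true → f m' = true} := by
  classical
  ext f
  constructor
  · rintro ⟨M, rfl⟩ m m' hm h
    have h' : m ∈ M := by simpa [indicator] using h
    have : m' ∈ M := M.heredity m h' m' hm
    simpa [indicator] using this
  · intro hf
    refine ⟨⟨{m | f m = true}, fun m hm m' hle => hf m m' hle hm⟩, ?_⟩
    funext m
    have : (m ∈ (⟨{m | f m = true}, fun m hm m' hle => hf m m' hle hm⟩ : Label)) ↔ f m = true :=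
      Iff.rfl
    simp [indicator, this]

instance : T2Space Label :=
  T2Space.of_injective_continuous indicator_injective continuous_induced_dom

instance : CompactSpace Label := by
  have hind : IsInducing indicator := ⟨rfl⟩
  have hcl : IsClosed (range indicator) := by
    rw [range_indicator]
    simp only [ofPred_forall]
    refine isClosed_iInter fun m => isClosed_iInter fun m' => isClosed_iInter fun _ => ?_
    have : IsClopen {f : FIN → Bool | f m = true} :=
      (isClopen_discrete {true}).preimage (continuous_apply m)
    have h' : IsClopen {f : FIN → Bool | f m' = true} :=
      (isClopen_discrete {true}).preimage (continuous_apply m')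
    convert (this.compl.union h').isClosed using 1
    ext f
    simp [imp_iff_not_or]
  exact (IsClosedEmbedding.mk ⟨hind, indicator_injective⟩ hcl).compactSpace

instance (M : Label) : CompactSpace M.Theta :=
  isCompact_iff_compactSpace.1 isClosed_closure.isCompact

theorem mem_sub {M : Label} {r w : FIN} : w ∈ M.sub r ↔ w + r ∈ M := Iff.rfl

theorem mem_of_le {M : Label} {m m' : FIN} (h : m' ≤ m) (hm : m ∈ M) : m' ∈ M :=
  M.heredity m hm m' h

theorem mem_of_mem_Theta {M N : Label} (hN : N ∈ M.Theta) {m : FIN} (hm : m ∈ N) : m ∈ M := by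
  obtain ⟨_, h1, r, rfl⟩ := mem_closure_iff.1 hN _ (isOpen_mem_iff m True) (by simpa using hm)
  have h1' : m ∈ M.sub r := by simpa using h1
  exact mem_of_le (self_le_add_right m r) h1'

theorem dense_orbit (M : Label) : Dense (range fun r : FIN => r +ᵥ M.toTheta) := by
  intro N
  rw [closure_subtype]
  have : ((↑) : M.Theta → Label) '' range (fun r : FIN => r +ᵥ M.toTheta) =
      range fun r : FIN => M.sub r := by
    rw [← range_comp]; rfl
  rw [this]
  exact N.2

/-- The limit of `P_r` along an ultrafilter, described by membership. -/
theorem exists_ultrafilter_mem_iff {M : Label} {Q : Function.End M.Theta}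
    (hQ : Q ∈ envelopingSemigroup FIN M.Theta) :
    ∃ U : Ultrafilter FIN, ∀ (N : M.Theta) (m : FIN),
      m ∈ (Q N).1 ↔ ∀ᶠ r in U, m + r ∈ N.1 := by
  obtain ⟨U, hU⟩ := exists_ultrafilter_of_mem_envelopingSet hQ
  refine ⟨U, fun N m => ?_⟩
  have h := tendsto_iff.1 ((continuous_subtype_val.tendsto _).comp (hU N)) m
  constructor
  · intro hm
    filter_upwards [h] with r hr
    exact hr.2 hm
  · intro hm
    obtain ⟨r, hr, hr'⟩ := (h.and hm).exists
    exact hr.1 hr'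

/-- Only finitely many vectors of a bounded label are supported in a given finite set. -/
theorem IsBounded.finite_setOf_support_subset {M : Label} (hM : M.IsBounded) (T : Finset ℕ+) :
    {m : FIN | m ∈ M ∧ m.support ⊆ T}.Finite := by
  obtain ⟨μ, hμ⟩ := hM
  refine (Set.finite_Iic (Finsupp.onFinset T (fun l => if l ∈ T then μ l else 0)
    (fun l h => by by_contra h'; simp [h'] at h) : FIN)).subset ?_
  rintro m ⟨hm, hT⟩ l
  rw [Finsupp.onFinset_apply]
  by_cases hl : l ∈ T
  · simpa [hl] using hμ m hm l
  · have : m l = 0 := by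
      by_contra h
      exact hl (hT (by simpa using h))
    simp [this]

/-- Given infinitely many such vectors a j, a diagonal choice yields s i with a j + s i ∈ M for j ≤
i and with supports of infinite union. The support of each a j is then one of the sets T of the
finitary condition. So finitely many supports occur, and boundedness leaves finitely many vectors.
-/
theorem IsFinitary.finite_setOf_eventually {M : Label} (hM : M.IsFinitary) {V : Filter FIN}
    [V.NeBot] (hV : V ≤ cofinite) : {m : FIN | ∀ᶠ s in V, m + s ∈ M}.Finite := by
  obtain ⟨hb, hfin⟩ := hM
  by_contra hinf
  have hinf : {m : FIN | ∀ᶠ s in V, m + s ∈ M}.Infinite := hinf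
  let a := hinf.natEmbedding
  have hs : ∀ i : ℕ, ∃ s : FIN, (∀ j ≤ i, (a j : FIN) + s ∈ M) ∧
      ¬ s.support ⊆ Finset.Iic i.succPNat := by
    intro i
    have h1 : ∀ᶠ s in V, ∀ j ≤ i, (a j : FIN) + s ∈ M :=
      (eventually_all_finite (Set.finite_Iic i)).2 fun j _ => (a j).2
    -- Only finitely many vectors of M live on [1, i + 1], and V avoids finite sets.
    have h2 : ∀ᶠ s in V, s ∉ {m : FIN | m ∈ M ∧ m.support ⊆ Finset.Iic i.succPNat} :=
      hV (hb.finite_setOf_support_subset _).compl_mem_cofinite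
    obtain ⟨s, hs1, hs2⟩ := (h1.and h2).exists
    exact ⟨s, hs1, fun h => hs2 ⟨mem_of_le (self_le_add_left s _) (hs1 i le_rfl), h⟩⟩
  choose s hs1 hs2 using hs
  have hun : (⋃ i, ((s i).support : Set ℕ+)).Infinite := by
    intro hf
    obtain ⟨B, hB⟩ := hf.bddAbove
    refine hs2 B fun l hl => Finset.mem_Iic.2 ?_
    have : l ≤ B := hB (mem_iUnion.2 ⟨B, hl⟩)
    refine this.trans ?_
    rw [← PNat.coe_le_coe, Nat.succPNat_coe]
    omega
  have hT := hfin (fun i => (s i).support) hun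
  have hfin' := hT.biUnion fun T _ => hb.finite_setOf_support_subset T
  refine (infinite_range_of_injective
    (Subtype.val_injective.comp a.injective)) (hfin'.subset ?_)
  rintro _ ⟨j, rfl⟩
  refine mem_biUnion (x := (a j : FIN).support) ?_
    ⟨mem_of_le (self_le_add_right _ (s j)) (hs1 j j le_rfl), subset_rfl⟩
  filter_upwards [eventually_ge_atTop j] with i hi
  refine ⟨a j + s i, hs1 i j hi, ?_⟩
  ext l
  simp [Nat.add_eq_zero_iff, imp_iff_not_or]

/-- At M this is an exchange of iterated limits, which is immediate if one ultrafilter is principal.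
Otherwise both iterated limits are empty. -/
theorem hasAbelianEnveloping {M : Label} (hM : M.IsFinitary) :
    HasAbelianEnveloping FIN M.Theta := by
  refine hasAbelianEnveloping_of_dense M.dense_orbit fun p hp q hq => ?_
  obtain ⟨U, hU⟩ := exists_ultrafilter_mem_iff hp
  obtain ⟨V, hV⟩ := exists_ultrafilter_mem_iff hq
  refine Subtype.ext (Label.ext (Set.ext fun m => ?_))
  change m ∈ (p (q M.toTheta)).1 ↔ m ∈ (q (p M.toTheta)).1
  rw [hU, hV]
  simp only [hU, hV]
  change (∀ᶠ r in U, ∀ᶠ s in V, m + r + s ∈ M) ↔ ∀ᶠ s in V, ∀ᶠ r in U, m + s + r ∈ M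
  have key : ∀ U V : Ultrafilter FIN, (U : Filter FIN) ≤ cofinite → (V : Filter FIN) ≤ cofinite →
      ¬ ∀ᶠ r in U, ∀ᶠ s in V, m + r + s ∈ M := by
    intro U V hU hV h
    -- By heredity, most r would lie in the finite set of vectors with r + s ∈ M for most s.
    have hf := hU (hM.finite_setOf_eventually hV).compl_mem_cofinite
    obtain ⟨r, hr, hr'⟩ := (h.and hf).exists
    refine hr' ?_
    filter_upwards [hr] with s hs
    exact mem_of_le (by rw [add_assoc]; exact self_le_add_left _ _) hs
  rcases U.le_cofinite_or_eq_pure with hU' | ⟨r, rfl⟩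
  · rcases V.le_cofinite_or_eq_pure with hV' | ⟨s, rfl⟩
    · exact iff_of_false (key U V hU' hV') (key V U hV' hU')
    · simp [add_right_comm]
  · simp [add_right_comm]

/-- A principal ultrafilter gives a translate of M, a nonprincipal one a finite label. -/
theorem countable_Theta {M : Label} (hM : M.IsFinitary) : M.Theta.Countable := by
  have hc : ((range fun r : FIN => M.sub r) ∪ {N : Label | N.carrier.Finite}).Countable := by
    refine (countable_range _).union ?_
    refine MapsTo.countable_of_injOn (f := carrier) (t := {s : Set FIN | s.Finite})
      (fun _ h => h) (fun _ _ _ _ h => Label.ext h) Set.Countable.ofPred_finite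
  refine hc.mono fun N hN => ?_
  obtain ⟨Q, hQ, h⟩ := exists_apply_eq_of_dense M.dense_orbit ⟨N, hN⟩
  obtain ⟨U, hU⟩ := exists_ultrafilter_mem_iff hQ
  have hN' : ∀ m, m ∈ N ↔ ∀ᶠ r in U, m + r ∈ M := fun m => by
    have := hU M.toTheta m
    rwa [h] at this
  rcases U.le_cofinite_or_eq_pure with hU' | ⟨r, rfl⟩
  · refine Or.inr ((hM.finite_setOf_eventually hU').subset fun m hm => (hN' m).1 hm)
  · refine Or.inl ⟨r, Label.ext (Set.ext fun m => ?_)⟩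
    exact (by simpa using (hN' m).symm : m + r ∈ M ↔ m ∈ N)

end Label

end LabelShift

namespace LabelShift

/-! ### Expansions as finite sets -/

/-- A finite set of nonzero integers with distinct absolute values. -/
def IsAdmissible (e : Finset ℤ) : Prop := ∀ a ∈ e, -a ∉ e

theorem IsAdmissible.ne_zero {e : Finset ℤ} (he : IsAdmissible e) {a : ℤ} (ha : a ∈ e) :
    a ≠ 0 := by
  rintro rfl
  exact he 0 ha (by simpa using ha)

theorem IsAdmissible.mono {e f : Finset ℤ} (he : IsAdmissible e) (h : f ⊆ e) : IsAdmissible f :=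
  fun a ha ha' => he a (h ha) (h ha')

theorem IsAdmissible.eq_of_natAbs_eq {e : Finset ℤ} (he : IsAdmissible e) {a c : ℤ} (ha : a ∈ e)
    (hc : c ∈ e) (h : a.natAbs = c.natAbs) : a = c := by
  rcases Int.natAbs_eq_natAbs_iff.1 h with h | h
  · exact h
  · exact absurd ha (h ▸ he c hc)

/-- The coefficient of `k n` in the sum over `e`. -/
def coeff (e : Finset ℤ) (n : ℕ) : ℤ := ∑ a ∈ e with a.natAbs = n, a.sign

theorem IsAdmissible.coeff_eq {e : Finset ℤ} (he : IsAdmissible e) {a : ℤ} (ha : a ∈ e) :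
    coeff e a.natAbs = a.sign := by
  have : e.filter (fun c => c.natAbs = a.natAbs) = {a} := by
    ext c
    simp only [Finset.mem_filter, Finset.mem_singleton]
    exact ⟨fun h => he.eq_of_natAbs_eq h.1 ha h.2, by rintro rfl; exact ⟨ha, rfl⟩⟩
  rw [coeff, this, Finset.sum_singleton]

theorem exists_mem_of_coeff_ne_zero {e : Finset ℤ} {n : ℕ} (h : coeff e n ≠ 0) :
    ∃ a ∈ e, a.natAbs = n := by
  obtain ⟨a, ha, -⟩ := Finset.exists_ne_zero_of_sum_ne_zero h
  exact ⟨a, (Finset.mem_filter.1 ha).1, (Finset.mem_filter.1 ha).2⟩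

theorem IsAdmissible.abs_coeff_le {e : Finset ℤ} (he : IsAdmissible e) (n : ℕ) :
    |coeff e n| ≤ 1 := by
  by_cases h : coeff e n = 0
  · simp [h]
  · obtain ⟨a, ha, rfl⟩ := exists_mem_of_coeff_ne_zero h
    rw [he.coeff_eq ha, Int.abs_sign_of_ne_zero (he.ne_zero ha)]

theorem IsAdmissible.mem_of_coeff_eq {e f : Finset ℤ} (he : IsAdmissible e) (hf : IsAdmissible f)
    {a : ℤ} (h : coeff e a.natAbs = coeff f a.natAbs) (ha : a ∈ e) : a ∈ f := by
  rw [he.coeff_eq ha] at h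
  have h0 : a.sign ≠ 0 := by simpa using he.ne_zero ha
  obtain ⟨c, hc, hca⟩ := exists_mem_of_coeff_ne_zero (h ▸ h0)
  rw [← hca, hf.coeff_eq hc] at h
  have : a = c := by rw [← Int.sign_mul_natAbs a, h, ← hca, Int.sign_mul_natAbs]
  exact this ▸ hc

/-! ### Growth of k and rigidity of expansions -/

section Expanding

variable {b : ℕ} {k : ℤ → ℤ}

theorem sum_eq_sum_coeff_mul (hodd : ∀ n, k (-n) = -k n) {e : Finset ℤ} {n : ℕ}
    (hn : ∀ a ∈ e, a.natAbs < n) :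
    ∑ a ∈ e, k a = ∑ i ∈ Finset.range n, coeff e i * k i := by
  rw [← Finset.sum_fiberwise_of_maps_to (t := Finset.range n) (g := Int.natAbs)
    (fun a ha => Finset.mem_range.2 (hn a ha))]
  refine Finset.sum_congr rfl fun i _ => ?_
  rw [coeff, Finset.sum_mul]
  refine Finset.sum_congr rfl fun a ha => ?_
  have hi := (Finset.mem_filter.1 ha).2
  have h0 : k 0 = 0 := by have := hodd 0; simp at this; omega
  rcases lt_trichotomy a 0 with h | rfl | h
  · have : a = -(i : ℤ) := by omega
    rw [Int.sign_eq_neg_one_of_neg h, this, hodd]; ring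
  · simp [h0]
  · have : a = (i : ℤ) := by omega
    rw [Int.sign_eq_one_of_pos h, this]; ring

theorem IsExpandingFunction.apply_zero (hk : IsExpandingFunction b k) : k 0 = 0 := by
  have := hk.1 0; simp at this; omega

theorem IsExpandingFunction.sum_nonneg (hk : IsExpandingFunction b k) (n : ℕ) :
    0 ≤ ∑ i ∈ Finset.range n, k i := by
  induction n with
  | zero => simp
  | succ n ih =>
    rw [Finset.sum_range_succ]
    rcases n with _ | n
    · simp [hk.apply_zero]
    · have := hk.2 n
      have h2 : 0 ≤ (b : ℤ) * ∑ i ∈ Finset.range (n + 1), k i := by positivity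
      push_cast
      linarith

/-- Differences of two expansions have coefficients of absolute value at most 2. The third copy of
the sum is the surplus that gives the lower bound in `le_abs_sum`. -/
theorem IsExpandingFunction.lt_apply (hb : 3 ≤ b) (hk : IsExpandingFunction b k) {n : ℕ}
    (hn : n ≠ 0) : 3 * ∑ i ∈ Finset.range n, k i < k n := by
  obtain ⟨n, rfl⟩ := Nat.exists_eq_succ_of_ne_zero hn
  refine lt_of_le_of_lt ?_ (by simpa using hk.2 n)
  gcongr
  · exact hk.sum_nonneg _
  · exact_mod_cast hb

theorem IsExpandingFunction.apply_nonneg (hb : 3 ≤ b) (hk : IsExpandingFunction b k) (n : ℕ) :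
    0 ≤ k n := by
  rcases eq_or_ne n 0 with rfl | hn
  · simp [hk.apply_zero]
  · have := hk.lt_apply hb hn
    have := hk.sum_nonneg n
    linarith

theorem IsExpandingFunction.le_sum (hb : 3 ≤ b) (hk : IsExpandingFunction b k) (n : ℕ) :
    (n : ℤ) ≤ 1 + ∑ i ∈ Finset.range n, k i := by
  induction n with
  | zero => simp
  | succ n ih =>
    rw [Finset.sum_range_succ]
    rcases eq_or_ne n 0 with rfl | hn
    · simp [hk.apply_zero]
    · have := hk.lt_apply hb hn
      have := hk.sum_nonneg n
      push_cast
      linarith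

theorem IsExpandingFunction.le_abs_sum (hb : 3 ≤ b) (hk : IsExpandingFunction b k) (c : ℕ → ℤ)
    (hc : ∀ n, |c n| ≤ 2) {n : ℕ} (hn : c n ≠ 0) :
    (n : ℤ) ≤ |∑ i ∈ Finset.range (n + 1), c i * k i| := by
  rcases eq_or_ne n 0 with rfl | hn0
  · simp [hk.apply_zero]
  have h1 : |∑ i ∈ Finset.range n, c i * k i| ≤ 2 * ∑ i ∈ Finset.range n, k i := by
    rw [Finset.mul_sum]
    refine (Finset.abs_sum_le_sum_abs _ _).trans (Finset.sum_le_sum fun i _ => ?_)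
    rw [abs_mul, abs_of_nonneg (hk.apply_nonneg hb i)]
    exact mul_le_mul_of_nonneg_right (hc i) (hk.apply_nonneg hb i)
  have h2 : k n ≤ |c n * k n| := by
    rw [abs_mul, abs_of_nonneg (hk.apply_nonneg hb n)]
    exact le_mul_of_one_le_left (hk.apply_nonneg hb n) (Int.one_le_abs hn)
  have h3 := hk.lt_apply hb hn0
  have h4 := hk.le_sum hb n
  rw [Finset.sum_range_succ]
  have h5 := abs_sub_abs_le_abs_sub (c n * k n) (-∑ i ∈ Finset.range n, c i * k i)
  rw [abs_neg, sub_neg_eq_add, add_comm (c n * k n)] at h5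
  linarith

/-- If the coefficients differ at n, let m ≥ n be the largest index where they differ. The term at m
dominates all lower ones, so the sums differ by at least m. -/
theorem IsExpandingFunction.coeff_eq_of_lt (hb : 3 ≤ b) (hk : IsExpandingFunction b k)
    {e f : Finset ℤ} (he : IsAdmissible e) (hf : IsAdmissible f) {n : ℕ}
    (hn : |∑ a ∈ e, k a - ∑ a ∈ f, k a| < n) : coeff e n = coeff f n := by
  by_contra hne
  let N := (e ∪ f).sup Int.natAbs + 1
  have hN : ∀ a ∈ e ∪ f, a.natAbs < N := fun a ha => Nat.lt_succ_of_le (Finset.le_sup ha)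
  have hzero : ∀ i, N ≤ i → coeff e i - coeff f i = 0 := by
    intro i hi
    have h : ∀ g ⊆ e ∪ f, coeff g i = 0 := fun g hg => by
      by_contra h
      obtain ⟨a, ha, rfl⟩ := exists_mem_of_coeff_ne_zero h
      exact absurd (hN a (hg ha)) (by omega)
    rw [h e Finset.subset_union_left, h f Finset.subset_union_right, sub_zero]
  let c : ℕ → ℤ := fun i => coeff e i - coeff f i
  have hc : ∀ i, |c i| ≤ 2 := fun i =>
    (abs_sub _ _).trans (by linarith [he.abs_coeff_le i, hf.abs_coeff_le i])
  let P : ℕ → Prop := fun i => c i ≠ 0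
  have hnN : n ≤ N := by
    by_contra h
    exact hne (sub_eq_zero.1 (hzero n (by omega)))
  have hP : P n := sub_ne_zero.2 hne
  classical
  let m := Nat.findGreatest P N
  have hm : P m := Nat.findGreatest_spec hnN hP
  have hnm : n ≤ m := Nat.le_findGreatest hnN hP
  have hmN : m < N := by
    by_contra h
    exact hm (hzero m (by omega))
  have hsum : ∑ a ∈ e, k a - ∑ a ∈ f, k a = ∑ i ∈ Finset.range (m + 1), c i * k i := by
    rw [sum_eq_sum_coeff_mul hk.1 fun a ha => hN a (Finset.mem_union_left _ ha),
      sum_eq_sum_coeff_mul hk.1 fun a ha => hN a (Finset.mem_union_right _ ha),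
      ← Finset.sum_sub_distrib]
    simp_rw [← sub_mul]
    symm
    refine Finset.sum_subset (Finset.range_mono hmN) fun i hi hi' => ?_
    have : ¬ P i := Nat.findGreatest_is_greatest (by simpa using hi')
      (Finset.mem_range.1 hi).le
    have : c i = 0 := not_not.1 this
    simp [this]
  have := hk.le_abs_sum hb c hc hm
  rw [← hsum] at this
  omega

/-- Two expansions agree on the entries which are larger than the difference of their sums. -/
theorem IsExpandingFunction.mem_iff_of_lt (hb : 3 ≤ b) (hk : IsExpandingFunction b k)
    {e f : Finset ℤ} (he : IsAdmissible e) (hf : IsAdmissible f) {a : ℤ}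
    (ha : |∑ a ∈ e, k a - ∑ a ∈ f, k a| < |a|) : a ∈ e ↔ a ∈ f := by
  have h := hk.coeff_eq_of_lt hb he hf (n := a.natAbs) (by simpa using ha)
  exact ⟨he.mem_of_coeff_eq hf h, hf.mem_of_coeff_eq he h.symm⟩

theorem IsExpandingFunction.eq_of_sum_eq (hb : 3 ≤ b) (hk : IsExpandingFunction b k)
    {e f : Finset ℤ} (he : IsAdmissible e) (hf : IsAdmissible f)
    (h : ∑ a ∈ e, k a = ∑ a ∈ f, k a) : e = f := by
  ext a
  rcases eq_or_ne a 0 with rfl | ha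
  · exact iff_of_false (fun h => he.ne_zero h rfl) (fun h => hf.ne_zero h rfl)
  · exact hk.mem_iff_of_lt hb he hf (by simpa [h] using ha)

end Expanding

/-! ### Times with a prescribed kind of expansion -/

variable {b : ℕ} {k : ℤ → ℤ} {ell : ℕ+ → ℕ+} {P : ℤ → Prop}

/-- The length vector of an expansion, given as a finite set. -/
noncomputable def lengthOf (ell : ℕ+ → ℕ+) (e : Finset ℤ) : FIN :=
  ∑ a ∈ e, Finsupp.single (ell a.natAbs.toPNat') 1

theorem lengthOf_mono {e f : Finset ℤ} (h : e ⊆ f) : lengthOf ell e ≤ lengthOf ell f :=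
  Finset.sum_le_sum_of_subset h

theorem lengthOf_apply (e : Finset ℤ) (l : ℕ+) :
    lengthOf ell e l = (e.filter fun a => ell a.natAbs.toPNat' = l).card := by
  rw [lengthOf, Finsupp.finsetSum_apply, Finset.card_filter]
  exact Finset.sum_congr rfl fun a _ => Finsupp.single_apply

/-- The sums of the admissible sets with entries satisfying `P` and length vector in `M`. -/
def timesOf (k : ℤ → ℤ) (ell : ℕ+ → ℕ+) (P : ℤ → Prop) (M : Label) : Set ℤ :=
  {t | ∃ e, IsAdmissible e ∧ (∀ a ∈ e, P a) ∧ ∑ a ∈ e, k a = t ∧ lengthOf ell e ∈ M}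

theorem timesOf_mono {M N : Label} (h : ∀ m ∈ M, m ∈ N) :
    timesOf k ell P M ⊆ timesOf k ell P N :=
  fun _ ⟨e, h1, h2, h3, h4⟩ => ⟨e, h1, h2, h3, h _ h4⟩

/-- An expansion of the left-hand time has a sum differing from that of e by s, so it contains e,
and removing e leaves an expansion of s. Conversely, an expansion of s has entries at most |s| in
absolute value and can be joined to e. -/
theorem IsExpandingFunction.add_sum_mem_timesOf_iff (hb : 3 ≤ b) (hk : IsExpandingFunction b k)
    {e : Finset ℤ} (he : IsAdmissible e) (heP : ∀ a ∈ e, P a) {s : ℤ} (hs : ∀ a ∈ e, |s| < |a|)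
    (N : Label) :
    s + ∑ a ∈ e, k a ∈ timesOf k ell P N ↔ s ∈ timesOf k ell P (N.sub (lengthOf ell e)) := by
  constructor
  · rintro ⟨g, hg, hgP, hsum, hlen⟩
    have hsub : e ⊆ g := fun a ha =>
      (hk.mem_iff_of_lt hb hg he (by simpa [hsum] using hs a ha)).2 ha
    refine ⟨g \ e, hg.mono Finset.sdiff_subset, fun a ha => hgP a (Finset.sdiff_subset ha), ?_, ?_⟩
    · rw [← Finset.sum_sdiff hsub] at hsum
      linarith
    · rw [Label.mem_sub, lengthOf, lengthOf, Finset.sum_sdiff hsub]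
      exact hlen
  · rintro ⟨f, hf, hfP, hsum, hlen⟩
    have hle : ∀ a ∈ f, |a| ≤ |s| := by
      intro a ha
      by_contra h
      -- Comparison with the empty expansion of 0: an entry beyond |s| would belong to it.
      have := (hk.mem_iff_of_lt hb hf (f := ∅) (a := a) (by simp [IsAdmissible])
        (by simpa [hsum] using h)).1 ha
      simp at this
    have hdisj : Disjoint f e := Finset.disjoint_left.2 fun a h1 h2 =>
      absurd (hs a h2) (hle a h1).not_gt
    refine ⟨f ∪ e, ?_, ?_, ?_, ?_⟩
    · intro a ha ha'
      rcases Finset.mem_union.1 ha with h | h <;> rcases Finset.mem_union.1 ha' with h' | h'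
      · exact hf a h h'
      · have := hs _ h'; have := hle _ h; rw [abs_neg] at *; omega
      · have := hs _ h; have := hle _ h'; rw [abs_neg] at *; omega
      · exact he a h h'
    · intro a ha
      rcases Finset.mem_union.1 ha with h | h
      exacts [hfP a h, heP a h]
    · rw [Finset.sum_union hdisj, hsum]
    · rw [lengthOf, Finset.sum_union hdisj]
      exact hlen

/-- Each vector is the length vector of an expansion with arbitrarily large entries. -/
theorem exists_lengthOf_eq (hell : IsSupportMap ell) (hP : ∀ a, 0 < a → P a) (r : FIN) (n : ℕ) :
    ∃ e, IsAdmissible e ∧ (∀ a ∈ e, P a) ∧ (∀ a ∈ e, (n : ℤ) < |a|) ∧ lengthOf ell e = r := by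
  suffices h : ∃ e : Finset ℤ, (∀ a ∈ e, (n : ℤ) < a) ∧ lengthOf ell e = r by
    obtain ⟨e, he, hr⟩ := h
    refine ⟨e, fun a ha ha' => ?_, fun a ha => hP a ?_, fun a ha => (he a ha).trans_le
      (le_abs_self a), hr⟩
    · have := he _ ha; have := he _ ha'; omega
    · have := he _ ha; omega
  induction r using Finsupp.induction_linear generalizing n with
  | zero => exact ⟨∅, by simp, by simp [lengthOf]⟩
  | add r s hr hs =>
    obtain ⟨e, he, rfl⟩ := hr n
    -- Entries beyond those of e make the union disjoint, so that length vectors add.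
    obtain ⟨f, hf, rfl⟩ := hs (max n (e.sup Int.natAbs))
    have hdisj : Disjoint e f := Finset.disjoint_left.2 fun a h1 h2 => by
      have h3 := hf a h2
      have h4 : a.natAbs ≤ e.sup Int.natAbs := Finset.le_sup h1
      have := he a h1
      omega
    refine ⟨e ∪ f, fun a ha => ?_, by rw [lengthOf, Finset.sum_union hdisj]; rfl⟩
    rcases Finset.mem_union.1 ha with h | h
    · exact he a h
    · have := hf a h; omega
  | single l c =>
    have hinf : {m : ℕ+ | ell m = l ∧ n < (m : ℕ)}.Infinite := by
      have : {m : ℕ+ | (m : ℕ) ≤ n}.Finite :=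
        (Set.finite_Iic n).preimage fun _ _ _ _ h => PNat.coe_injective h
      refine ((hell.1 l).sdiff this).mono fun m hm => ⟨hm.1, not_le.1 hm.2⟩
    obtain ⟨T, hT, hcard⟩ := hinf.exists_subset_card_eq c
    have hinj : Function.Injective fun m : ℕ+ => ((m : ℕ) : ℤ) := fun m m' h =>
      PNat.coe_injective (Nat.cast_injective (R := ℤ) h)
    refine ⟨T.map ⟨_, hinj⟩, ?_, ?_⟩
    · intro a ha
      obtain ⟨m, hm, rfl⟩ := Finset.mem_map.1 ha
      exact Int.ofNat_lt.2 (hT hm).2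
    · rw [lengthOf, Finset.sum_map, Finset.sum_congr rfl (g := fun _ => Finsupp.single l 1)]
      · simp [hcard]
      · intro m hm
        simp [(hT hm).1]

theorem timesOf_true (k : ℤ → ℤ) (ell : ℕ+ → ℕ+) (M : Label) :
    timesOf k ell (fun _ => True) M = timeSet k ell M := by
  ext t
  constructor
  · rintro ⟨e, he, -, rfl, hlen⟩
    have : ∃ j : List ℤ, j.Pairwise (fun a c => |c| < |a|) ∧ j.toFinset = e := by
      clear hlen
      induction e using Finset.induction_on_max_value (fun a : ℤ => |a|) with
      | empty => exact ⟨[], by simp⟩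
      | insert a s ha hmax ih =>
        obtain ⟨j, hj, hjs⟩ := ih (he.mono (Finset.subset_insert a s))
        refine ⟨a :: j, List.pairwise_cons.2 ⟨fun c hc => ?_, hj⟩, by simp [hjs]⟩
        have hcs : c ∈ s := by rw [← hjs]; simpa using hc
        refine lt_of_le_of_ne (hmax c hcs) fun h => ha ?_
        have := he.eq_of_natAbs_eq (Finset.mem_insert_of_mem hcs) (Finset.mem_insert_self a s)
          (Int.natAbs_eq_natAbs_iff.2 (abs_eq_abs.1 h))
        exact this ▸ hcs
    obtain ⟨j, hj, rfl⟩ := this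
    have hnd : j.Nodup := hj.imp fun h h' => by simp [h'] at h
    refine ⟨j, ⟨hj, fun a ha => he.ne_zero (by simpa using ha), ?_⟩, ?_⟩
    · rw [List.sum_toFinset _ hnd]
    · rwa [lengthVector, ← List.sum_toFinset _ hnd]
  · rintro ⟨j, ⟨hj, h0, rfl⟩, hlen⟩
    have hnd : j.Nodup := hj.imp fun h h' => by simp [h'] at h
    refine ⟨j.toFinset, fun a ha ha' => ?_, by simp, List.sum_toFinset _ hnd, ?_⟩
    · rw [List.mem_toFinset] at ha ha'
      have hne : a ≠ -a := by have := h0 a ha; omega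
      have hj' : j.Pairwise fun a c => |a| ≠ |c| := hj.imp fun h => h.ne'
      have : Std.Symm fun a c : ℤ => |a| ≠ |c| := ⟨fun _ _ h => h.symm⟩
      exact hj'.forall ha ha' hne (abs_neg a).symm
    · rwa [lengthOf, List.sum_toFinset _ hnd]

/-- By uniqueness of expansions, the expansion witnessing A[M] is the positive one read off from the
sum in IP₊(k). -/
theorem IsExpandingFunction.timesOf_pos (hb : 3 ≤ b) (hk : IsExpandingFunction b k)
    (ell : ℕ+ → ℕ+) (M : Label) :
    timesOf k ell (fun a => 0 < a) M = timeSet k ell M ∩ posIP k := by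
  rw [← timesOf_true]
  ext t
  constructor
  · rintro ⟨e, he, hpos, rfl, hlen⟩
    refine ⟨⟨e, he, by simp, rfl, hlen⟩, e.image k, ?_, ?_⟩
    · rw [Finset.coe_image]
      exact image_mono fun a ha => (hpos a ha).le
    · rw [Finset.sum_image]
      intro a ha c hc hac
      -- Injectivity of k on e is uniqueness of expansions applied to singletons.
      have hadm : ∀ x ∈ e, IsAdmissible {x} := fun x hx => he.mono (by simpa using hx)
      have := hk.eq_of_sum_eq hb (hadm a ha) (hadm c hc) (by simpa using hac)
      simpa using this
  · rintro ⟨⟨e, he, -, hsum, hlen⟩, F, hF, hFsum⟩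
    choose! g hg hkg using hF
    -- IP₊(k) admits the summand k 0 = 0, which an expansion excludes.
    have hG : t = ∑ a ∈ (F.image g).erase 0, k a := by
      rw [Finset.sum_erase _ hk.apply_zero, Finset.sum_image, hFsum]
      · exact Finset.sum_congr rfl fun a ha => (hkg ha).symm
      · intro a ha c hc hac
        rw [← hkg ha, ← hkg hc, hac]
    have hpos : ∀ a ∈ (F.image g).erase 0, 0 < a := by
      intro a ha
      obtain ⟨h0, ha⟩ := Finset.mem_erase.1 ha
      obtain ⟨c, hc, rfl⟩ := Finset.mem_image.1 ha
      exact lt_of_le_of_ne (hg hc) h0.symm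
    have hadm : IsAdmissible ((F.image g).erase 0) := fun a ha ha' => by
      have := hpos a ha; have := hpos _ ha'; omega
    have := hk.eq_of_sum_eq hb he hadm (hsum.trans hG)
    exact ⟨e, he, this ▸ hpos, hsum, hlen⟩

end LabelShift

namespace LabelShift

/-! ### The points `x[M]` and their orbit closures -/

/-- The characteristic function of `timesOf k ell P M`. -/
noncomputable def pointOf (k : ℤ → ℤ) (ell : ℕ+ → ℕ+) (P : ℤ → Prop) (M : Label) : ℤ → Bool :=
  chi (timesOf k ell P M)

instance (x : ℤ → Bool) : CompactSpace (orbitClosure x) :=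
  isCompact_iff_compactSpace.1 isClosed_closure.isCompact

theorem chi_apply_eq_true {A : Set ℤ} {t : ℤ} : chi A t = true ↔ t ∈ A := by
  simp [chi]

theorem tendsto_points_iff {ι : Type*} {F : Filter ι} {f : ι → ℤ → Bool} {z : ℤ → Bool} :
    Tendsto f F (𝓝 z) ↔ ∀ t, ∀ᶠ i in F, (f i t = true ↔ z t = true) := by
  rw [tendsto_pi_nhds]
  refine forall_congr' fun t => ?_
  rw [nhds_discrete, tendsto_pure]
  simp

theorem apply_eq_true_iff_of_tendsto {ι : Type*} {U : Filter ι} [U.NeBot] {f : ι → ℤ → Bool}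
    {z : ℤ → Bool} (h : Tendsto f U (𝓝 z)) (t : ℤ) :
    z t = true ↔ ∀ᶠ i in U, f i t = true := by
  have ht := tendsto_points_iff.1 h t
  constructor
  · intro hz
    filter_upwards [ht] with i hi using hi.2 hz
  · intro hz
    obtain ⟨i, hi, hi'⟩ := (ht.and hz).exists
    exact hi.1 hi'

theorem isSubshift_orbitClosure (x : ℤ → Bool) : IsSubshift (orbitClosure x) := by
  refine ⟨isClosed_closure, Subset.antisymm ?_ fun y hy => ?_⟩
  · rintro _ ⟨y, hy, rfl⟩
    exact shift_mem_orbitClosure 1 hy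
  · exact ⟨shift (-1) y, shift_mem_orbitClosure _ hy, by funext t; simp [shift]⟩

theorem dense_orbit_basePoint (x : ℤ → Bool) :
    Dense (range fun n : ℤ => n +ᵥ basePoint x) := by
  intro y
  rw [closure_subtype]
  have : ((↑) : orbitClosure x → ℤ → Bool) '' range (fun n : ℤ => n +ᵥ basePoint x) =
      range fun n : ℤ => shift n x := by
    rw [← range_comp]; rfl
  rw [this]
  exact y.2

variable {b : ℕ} {k : ℤ → ℤ} {ell : ℕ+ → ℕ+} {P : ℤ → Prop}

/-- An integer has at most one expansion, so each coordinate depends on the membership of at most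
one vector. -/
theorem IsExpandingFunction.continuous_pointOf (hb : 3 ≤ b) (hk : IsExpandingFunction b k) :
    Continuous (pointOf k ell P) := by
  refine continuous_iff_continuousAt.2 fun N => tendsto_points_iff.2 fun s => ?_
  simp only [pointOf, chi_apply_eq_true]
  by_cases h : ∃ e, IsAdmissible e ∧ (∀ a ∈ e, P a) ∧ ∑ a ∈ e, k a = s
  · obtain ⟨e, he, hP, hs⟩ := h
    have key : ∀ N : Label, s ∈ timesOf k ell P N ↔ lengthOf ell e ∈ N := fun N => by
      refine ⟨?_, fun h => ⟨e, he, hP, hs, h⟩⟩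
      rintro ⟨f, hf, -, hfs, hlen⟩
      rwa [hk.eq_of_sum_eq hb he hf (hs.trans hfs.symm)]
    simp only [key]
    exact Label.tendsto_iff.1 tendsto_id _
  · have key : ∀ N : Label, s ∉ timesOf k ell P N := fun N ⟨e, he, hP, hs, _⟩ =>
      h ⟨e, he, hP, hs⟩
    simp [key]

/-- The times are sums of expansions of length vector r with entries beyond n; coordinate s is
settled once n ≥ |s|. One sequence serves every N. -/
theorem IsExpandingFunction.exists_tendsto_shift (hb : 3 ≤ b) (hk : IsExpandingFunction b k)
    (hell : IsSupportMap ell) (hP : ∀ a, 0 < a → P a) (r : FIN) :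
    ∃ t : ℕ → ℤ, ∀ N, Tendsto (fun n => shift (t n) (pointOf k ell P N)) atTop
      (𝓝 (pointOf k ell P (N.sub r))) := by
  choose e he heP hlarge hlen using fun n => exists_lengthOf_eq hell hP r n
  refine ⟨fun n => ∑ a ∈ e n, k a, fun N => tendsto_points_iff.2 fun s => ?_⟩
  filter_upwards [eventually_ge_atTop s.natAbs] with n hn
  simp only [shift, pointOf, chi_apply_eq_true]
  rw [hk.add_sum_mem_timesOf_iff hb (he n) (heP n), hlen]
  intro a ha
  have := hlarge n a ha
  rw [Int.abs_eq_natAbs s]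
  omega

/-- The entries which occur in most members of a family of expansions, with length vectors in a
finitary label, are finite in number. -/
theorem finite_setOf_eventually_mem {M : Label} (hM : M.IsFinitary) {ι : Type*} {V : Filter ι}
    [V.NeBot] {e : ι → Finset ℤ} (he : ∀ᶠ t in V, lengthOf ell (e t) ∈ M) :
    {a : ℤ | ∀ᶠ t in V, a ∈ e t}.Finite := by
  obtain ⟨⟨μ, hμ⟩, hfin⟩ := hM
  set L := {a : ℤ | ∀ᶠ t in V, a ∈ e t} with hL
  have hsub : ∀ G : Finset ℤ, (G : Set ℤ) ⊆ L → lengthOf ell G ∈ M := by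
    intro G hG
    have h : ∀ᶠ t in V, ∀ a ∈ G, a ∈ e t := (Filter.eventually_all_finset G).2 hG
    obtain ⟨t, ht, ht'⟩ := (h.and he).exists
    exact Label.mem_of_le (lengthOf_mono ht) ht'
  by_contra hinf
  let c : ℤ → ℕ+ := fun a => ell a.natAbs.toPNat'
  -- Boundedness allows at most μ l entries of L over l, so an infinite L meets infinitely many l.
  have hfib : ∀ l, {a ∈ L | c a = l}.Finite := by
    intro l
    by_contra h
    obtain ⟨G, hG, hcard⟩ := (show Set.Infinite _ from h).exists_subset_card_eq (μ l + 1)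
    have h1 := hμ _ (hsub G fun a ha => (hG ha).1) l
    rw [lengthOf_apply, Finset.filter_true_of_mem fun a ha => (hG ha).2] at h1
    omega
  let a := (show L.Infinite from hinf).natEmbedding
  have hc : (range fun i => c (a i)).Infinite := by
    intro h
    refine infinite_range_of_injective (Subtype.val_injective.comp a.injective)
      ((h.biUnion fun l _ => hfib l).subset ?_)
    rintro _ ⟨i, rfl⟩
    exact mem_biUnion (mem_range_self i) ⟨(a i).2, rfl⟩
  -- The S i increase, so each singleton {c (a i)} is eventually absorbed. This gives infinitely
  -- many admissible T, against finitariness.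
  let S : ℕ → Finset ℕ+ := fun i => (Finset.range (i + 1)).image fun j => c (a j)
  have hS : ∀ i, S i ∈ M.Supp := by
    intro i
    let G : Finset ℤ := (Finset.range (i + 1)).image fun j => (a j : ℤ)
    refine ⟨lengthOf ell G, hsub G ?_, ?_⟩
    · intro x hx
      obtain ⟨j, -, rfl⟩ := Finset.mem_image.1 hx
      exact (a j).2
    · ext l
      rw [Finsupp.mem_support_iff, lengthOf_apply, Finset.card_ne_zero]
      simp [Finset.Nonempty, G, S, c]
  have hun : (⋃ i, (S i : Set ℕ+)).Infinite := by
    refine hc.mono ?_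
    rintro _ ⟨i, rfl⟩
    exact mem_iUnion.2 ⟨i, Finset.mem_coe.2 (Finset.mem_image_of_mem _ (by simp))⟩
  refine (hc.image Finset.singleton_injective.injOn) ((hfin S hun).subset ?_)
  rintro _ ⟨_, ⟨i, rfl⟩, rfl⟩
  filter_upwards [eventually_ge_atTop i] with j hj
  have : c (a i) ∈ S j := Finset.mem_image_of_mem _ (Finset.mem_range.2 (by omega))
  rw [Finset.union_eq_right.2 (Finset.singleton_subset_iff.2 this)]
  exact hS j

/-- Let L be the finite set of entries common to most expansions. Then v is the sum over L, and W is
the distribution of the length vectors of what remains, whose entries leave every finite set. -/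
theorem IsExpandingFunction.exists_ultrafilter_translate (hb : 3 ≤ b)
    (hk : IsExpandingFunction b k) {M : Label} (hM : M.IsFinitary) {V : Ultrafilter ℤ}
    (hV : ∀ᶠ t in V, t ∈ timesOf k ell P M) :
    ∃ (v : ℤ) (W : Ultrafilter FIN), ∀ (N : Label) (s : ℤ),
      (∀ᶠ t in V, s + t ∈ timesOf k ell P N) ↔
        ∀ᶠ r in W, s + v ∈ timesOf k ell P (N.sub r) := by
  have hV' : ∀ t, ∃ e, t ∈ timesOf k ell P M → IsAdmissible e ∧ (∀ a ∈ e, P a) ∧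
      ∑ a ∈ e, k a = t ∧ lengthOf ell e ∈ M := fun t => by
    by_cases h : t ∈ timesOf k ell P M
    · obtain ⟨e, he⟩ := h
      exact ⟨e, fun _ => he⟩
    · exact ⟨∅, fun h' => absurd h' h⟩
  choose e he using hV'
  have hfin := finite_setOf_eventually_mem hM (hV.mono fun t ht => (he t ht).2.2.2)
  let L := hfin.toFinset
  refine ⟨∑ a ∈ L, k a, V.map fun t => lengthOf ell (e t \ L), fun N s => ?_⟩
  rw [Ultrafilter.coe_map, eventually_map]
  refine eventually_congr ?_
  have h1 : ∀ᶠ t in V, ∀ a ∈ L, a ∈ e t :=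
    (Filter.eventually_all_finset L).2 fun a ha => hfin.mem_toFinset.1 ha
  -- Since V is an ultrafilter, an entry outside L is absent from most expansions. Finitely many
  -- entries have to be excluded for a given s.
  have h2 : ∀ᶠ t in V, ∀ a ∈ Finset.Icc (-|s + ∑ a ∈ L, k a|) |s + ∑ a ∈ L, k a|,
      a ∉ e t \ L := by
    refine (Filter.eventually_all_finset _).2 fun a _ => ?_
    by_cases ha : a ∈ L
    · simp [ha]
    · have : ¬ ∀ᶠ t in V, a ∈ e t := fun h => ha (hfin.mem_toFinset.2 h)
      filter_upwards [Ultrafilter.eventually_not.2 this] with t ht h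
      exact ht (Finset.mem_sdiff.1 h).1
  filter_upwards [hV, h1, h2] with t ht hL hlarge
  obtain ⟨hadm, hP, hsum, -⟩ := he t ht
  rw [← hk.add_sum_mem_timesOf_iff hb (hadm.mono Finset.sdiff_subset)
    fun a ha => hP a (Finset.sdiff_subset ha)]
  · rw [add_assoc, add_comm (∑ a ∈ L, k a), Finset.sum_sdiff hL, hsum]
  · intro a ha
    by_contra h
    exact hlarge a (Finset.mem_Icc.2 (abs_le.1 (not_lt.1 h))) ha

theorem IsExpandingFunction.pointOf_mem_orbitClosure (hb : 3 ≤ b) (hk : IsExpandingFunction b k)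
    (hell : IsSupportMap ell) (hP : ∀ a, 0 < a → P a) {M N : Label} (hN : N ∈ M.Theta) :
    pointOf k ell P N ∈ orbitClosure (pointOf k ell P M) := by
  have hcl : IsClosed (pointOf k ell P ⁻¹' orbitClosure (pointOf k ell P M)) :=
    isClosed_closure.preimage (hk.continuous_pointOf hb)
  refine closure_minimal ?_ hcl hN
  rintro _ ⟨r, rfl⟩
  obtain ⟨t, ht⟩ := hk.exists_tendsto_shift hb hell hP r
  exact mem_closure_of_tendsto (ht M) (Eventually.of_forall fun n => ⟨t n, rfl⟩)

/-- Each element of the enveloping semigroup of `Θ(M)` is matched by one of the orbit closure. -/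
theorem IsExpandingFunction.exists_induced (hb : 3 ≤ b) (hk : IsExpandingFunction b k)
    (hell : IsSupportMap ell) (hP : ∀ a, 0 < a → P a) {M : Label} {Q : Function.End M.Theta}
    (hQ : Q ∈ envelopingSemigroup FIN M.Theta) :
    ∃ q ∈ envelopingSemigroup ℤ (orbitClosure (pointOf k ell P M)),
      ∀ (N : M.Theta) (h : pointOf k ell P N ∈ orbitClosure (pointOf k ell P M)),
        (q ⟨_, h⟩ : orbitClosure (pointOf k ell P M)).1 = pointOf k ell P (Q N : M.Theta).1 := by
  have hr : ∀ r : FIN, ∃ q ∈ envelopingSet ℤ (orbitClosure (pointOf k ell P M)),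
      ∀ (N : M.Theta) (h : pointOf k ell P N ∈ orbitClosure (pointOf k ell P M)),
        (q ⟨_, h⟩).1 = pointOf k ell P (N.1.sub r) := by
    intro r
    obtain ⟨t, ht⟩ := hk.exists_tendsto_shift hb hell hP r
    -- Convergence is known only at the points coming from labels; an ultrafilter finer than `atTop`
    -- provides a limit on the whole orbit closure.
    obtain ⟨q, hq, hlim⟩ := exists_mem_envelopingSet_of_ultrafilter (hyperfilter ℕ)
      (fun n (z : orbitClosure (pointOf k ell P M)) => t n +ᵥ z)
      (fun n => vadd_mem_envelopingSemigroup (t n))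
    refine ⟨q, hq, fun N h => tendsto_nhds_unique
      ((continuous_subtype_val.tendsto _).comp (hlim ⟨_, h⟩)) ((ht N).mono_left ?_)⟩
    rw [← Nat.cofinite_eq_atTop]
    exact hyperfilter_le_cofinite
  choose f hf hfN using hr
  obtain ⟨U, hU⟩ := exists_ultrafilter_of_mem_envelopingSet hQ
  obtain ⟨q, hq, hlim⟩ := exists_mem_envelopingSet_of_ultrafilter U f hf
  refine ⟨q, hq, fun N h => tendsto_nhds_unique
    ((continuous_subtype_val.tendsto _).comp (hlim ⟨_, h⟩)) ?_⟩
  have h1 := (((hk.continuous_pointOf hb (ell := ell) (P := P)).comp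
    continuous_subtype_val).tendsto _).comp (hU N)
  refine h1.congr fun r => ?_
  simp only [Function.comp, hfN r N h]
  rfl

/-- An element of the enveloping semigroup of the orbit closure annihilates all points coming from
`Θ(M)`, or is on them a shift of a map coming from the enveloping semigroup of `Θ(M)`. -/
theorem IsExpandingFunction.eq_zero_or_eq_shift (hb : 3 ≤ b) (hk : IsExpandingFunction b k)
    {M : Label} (hM : M.IsFinitary) {p : Function.End (orbitClosure (pointOf k ell P M))}
    (hp : p ∈ envelopingSemigroup ℤ (orbitClosure (pointOf k ell P M))) :
    (∀ (N : M.Theta) (h : pointOf k ell P N ∈ orbitClosure (pointOf k ell P M)),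
      (p ⟨_, h⟩ : orbitClosure (pointOf k ell P M)).1 = fun _ => false) ∨
    ∃ (n : ℤ), ∃ Q ∈ envelopingSemigroup FIN M.Theta,
      ∀ (N : M.Theta) (h : pointOf k ell P N ∈ orbitClosure (pointOf k ell P M)),
        (p ⟨_, h⟩ : orbitClosure (pointOf k ell P M)).1 =
          shift n (pointOf k ell P (Q N : M.Theta).1) := by
  obtain ⟨U, hU⟩ := exists_ultrafilter_of_mem_envelopingSet hp
  have hpU : ∀ (N : M.Theta) (h : pointOf k ell P N ∈ orbitClosure (pointOf k ell P M)) (s : ℤ),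
      (p ⟨_, h⟩ : orbitClosure (pointOf k ell P M)).1 s = true ↔
        ∀ᶠ t in U, s + t ∈ timesOf k ell P N.1 := by
    intro N h s
    rw [apply_eq_true_iff_of_tendsto ((continuous_subtype_val.tendsto _).comp (hU ⟨_, h⟩)) s]
    refine eventually_congr (Eventually.of_forall fun t => ?_)
    exact chi_apply_eq_true
  -- If the image of the point of M is nonzero at s, translating U by s concentrates it on the times
  -- of M; the shift by v - s undoes this translation.
  by_cases hs : ∃ s, ∀ᶠ t in U, s + t ∈ timesOf k ell P M
  · right
    obtain ⟨s, hs⟩ := hs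
    obtain ⟨v, W, hW⟩ := hk.exists_ultrafilter_translate hb hM (V := U.map fun t => s + t)
      (by rwa [Ultrafilter.coe_map, eventually_map])
    obtain ⟨Q, hQ, hlim⟩ := exists_mem_envelopingSet_of_ultrafilter W
      (fun r (N : M.Theta) => r +ᵥ N) (fun r => vadd_mem_envelopingSemigroup r)
    refine ⟨v - s, Q, hQ, fun N h => funext fun u => Bool.eq_iff_iff.2 ?_⟩
    have h1 := (((hk.continuous_pointOf hb (ell := ell) (P := P)).comp
      continuous_subtype_val).tendsto _).comp (hlim N)
    change _ ↔ pointOf k ell P (Q N : M.Theta).1 (u + (v - s)) = true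
    have h2 := hW N.1 (u - s)
    rw [Ultrafilter.coe_map, eventually_map] at h2
    rw [hpU]
    refine Iff.trans ?_ (apply_eq_true_iff_of_tendsto h1 _).symm
    have e1 : ∀ t, u - s + (s + t) = u + t := fun t => by ring
    have e2 : u - s + v = u + (v - s) := by ring
    simp only [e1, e2] at h2
    rw [h2]
    exact eventually_congr (Eventually.of_forall fun r => chi_apply_eq_true.symm)
  · left
    refine fun N h => funext fun s => Bool.eq_false_iff.2 fun hN => hs ⟨s, ?_⟩
    filter_upwards [(hpU N h s).1 hN] with t ht
    -- Labels in Θ(M) are contained in M, so vanishing for M forces vanishing for all of them.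
    exact timesOf_mono (fun m hm => Label.mem_of_mem_Theta N.2 hm) ht

theorem shift_of_mem_envelopingSemigroup {x : ℤ → Bool} {p : Function.End (orbitClosure x)}
    (hp : p ∈ envelopingSemigroup ℤ (orbitClosure x)) (n : ℤ) (z : orbitClosure x) :
    p (n +ᵥ z) = n +ᵥ p z := by
  obtain ⟨U, hU⟩ := exists_ultrafilter_of_mem_envelopingSet hp
  refine tendsto_nhds_unique (hU (n +ᵥ z)) ?_
  refine (((continuous_const_vadd n).tendsto _).comp (hU z)).congr fun m => ?_
  exact vadd_comm n m z

end LabelShift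

namespace LabelShift

/-! ### Countability, commutativity and the induced homomorphism -/

variable {b : ℕ} {k : ℤ → ℤ} {ell : ℕ+ → ℕ+} {P : ℤ → Prop}

theorem IsExpandingFunction.countable_orbitClosure (hb : 3 ≤ b) (hk : IsExpandingFunction b k)
    {M : Label} (hM : M.IsFinitary) : (orbitClosure (pointOf k ell P M)).Countable := by
  have hc : (insert (fun _ => false)
      (image2 (fun (n : ℤ) N => shift n (pointOf k ell P N)) univ M.Theta)).Countable :=
    (countable_univ.image2 (Label.countable_Theta hM) _).insert _
  refine hc.mono fun z hz => ?_
  obtain ⟨p, hp, h⟩ := exists_apply_eq_of_dense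
    (dense_orbit_basePoint (pointOf k ell P M)) ⟨z, hz⟩
  rcases hk.eq_zero_or_eq_shift hb hM hp with h0 | ⟨n, Q, -, hQ⟩
  · left
    have := h0 M.toTheta (basePoint _).2
    rw [← this]
    exact (congrArg Subtype.val h).symm
  · right
    refine ⟨n, trivial, _, (Q M.toTheta : M.Theta).2, ?_⟩
    have := hQ M.toTheta (basePoint _).2
    exact this.symm.trans (congrArg Subtype.val h)

/-- On shifts of the points coming from Θ(M), an element is either zero or a shift combined with
some Q. Zero is fixed by the whole semigroup, shifts add, and the maps Q commute. -/
theorem IsExpandingFunction.hasAbelianEnveloping_orbitClosure (hb : 3 ≤ b)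
    (hk : IsExpandingFunction b k) (hell : IsSupportMap ell) (hP : ∀ a, 0 < a → P a) {M : Label}
    (hM : M.IsFinitary) : HasAbelianEnveloping ℤ (orbitClosure (pointOf k ell P M)) := by
  set X := orbitClosure (pointOf k ell P M) with hX
  have hmem : ∀ N : M.Theta, pointOf k ell P N ∈ X := fun N =>
    hk.pointOf_mem_orbitClosure hb hell hP N.2
  let y : M.Theta → X := fun N => ⟨_, hmem N⟩
  have key : ∀ p ∈ envelopingSemigroup ℤ X,
      (∀ (N : M.Theta) (n : ℤ), (p (n +ᵥ y N) : X).1 = fun _ => false) ∨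
      ∃ (m : ℤ), ∃ Q ∈ envelopingSemigroup FIN M.Theta,
        ∀ (N : M.Theta) (n : ℤ), p (n +ᵥ y N) = (m + n) +ᵥ y (Q N) := by
    intro p hp
    rcases hk.eq_zero_or_eq_shift hb hM hp with h0 | ⟨m, Q, hQ, h⟩
    · refine Or.inl fun N n => ?_
      rw [shift_of_mem_envelopingSemigroup hp]
      change shift n (p (y N) : X).1 = _
      rw [h0 N (hmem N)]
      rfl
    · refine Or.inr ⟨m, Q, hQ, fun N n => ?_⟩
      rw [shift_of_mem_envelopingSemigroup hp, add_comm, add_vadd]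
      congr 1
      exact Subtype.ext (h N (hmem N))
  have hzero : ∀ p ∈ envelopingSemigroup ℤ X, ∀ z : X, z.1 = (fun _ => false) →
      (p z : X).1 = fun _ => false := by
    intro p hp z hz
    obtain ⟨U, hU⟩ := exists_ultrafilter_of_mem_envelopingSet hp
    refine tendsto_nhds_unique ((continuous_subtype_val.tendsto _).comp (hU z)) ?_
    refine tendsto_const_nhds.congr fun n => ?_
    change _ = shift n z.1
    rw [hz]
    rfl
  refine hasAbelianEnveloping_of_dense (dense_orbit_basePoint _) fun p hp q hq => ?_
  have hx : basePoint (pointOf k ell P M) = (0 : ℤ) +ᵥ y M.toTheta := (zero_vadd ℤ _).symm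
  rw [hx]
  rcases key p hp with h0 | ⟨m, Q, hQ, h⟩ <;> rcases key q hq with h0' | ⟨m', Q', hQ', h'⟩
  · exact Subtype.ext ((hzero p hp _ (h0' _ _)).trans (hzero q hq _ (h0 _ _)).symm)
  · rw [h']
    exact Subtype.ext ((h0 _ _).trans (hzero q hq _ (h0 _ _)).symm)
  · rw [h]
    exact Subtype.ext ((hzero p hp _ (h0' _ _)).trans (h0' _ _).symm)
  · rw [h, h', h, h']
    have hc : Q (Q' M.toTheta) = Q' (Q M.toTheta) :=
      congrFun (Label.hasAbelianEnveloping hM Q hQ Q' hQ') M.toTheta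
    rw [hc, add_left_comm]

theorem apply_basePoint_of_isInduced {y : Label → ℤ → Bool} {M : Label}
    {J : envelopingSemigroup FIN M.Theta →* envelopingSemigroup ℤ (orbitClosure (y M))}
    (hJ : IsInduced y M J) (Q : envelopingSemigroup FIN M.Theta) :
    ((J Q).1 (basePoint (y M)) : orbitClosure (y M)).1 = y (Q.1 M.toTheta : M.Theta).1 :=
  (hJ Q M.toTheta).2

/-- The matching elements are chosen independently. They multiply correctly because, in an abelian
enveloping semigroup, the value at the base point determines an element. -/
theorem IsExpandingFunction.exists_isInduced (hb : 3 ≤ b)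
    (hk : IsExpandingFunction b k) (hell : IsSupportMap ell) (hP : ∀ a, 0 < a → P a) {M : Label}
    (hM : M.IsFinitary) : ∃ J, IsInduced (pointOf k ell P) M J := by
  choose f hf hfN using fun Q : envelopingSemigroup FIN M.Theta =>
    hk.exists_induced hb hell hP Q.2
  have hmem : ∀ N : M.Theta, pointOf k ell P N ∈ orbitClosure (pointOf k ell P M) := fun N =>
    hk.pointOf_mem_orbitClosure hb hell hP N.2
  have hab := hk.hasAbelianEnveloping_orbitClosure hb hell hP hM
  have hbase : ∀ Q, f Q (basePoint _) = ⟨_, hmem (Q.1 M.toTheta)⟩ := fun Q =>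
    Subtype.ext (hfN Q M.toTheta (hmem _))
  have hone : f 1 = 1 := eq_of_apply_eq_of_dense (dense_orbit_basePoint _) hab (hf _)
    (one_mem _) (hbase 1)
  have hmul : ∀ Q Q', f (Q * Q') = f Q * f Q' := fun Q Q' => by
    refine eq_of_apply_eq_of_dense (dense_orbit_basePoint _) hab (hf _)
      (mul_mem (hf Q) (hf Q')) ?_
    change _ = f Q (f Q' (basePoint _))
    rw [hbase, hbase]
    exact Subtype.ext (hfN Q _ _).symm
  exact ⟨⟨⟨fun Q => ⟨f Q, hf Q⟩, Subtype.ext hone⟩, fun Q Q' => Subtype.ext (hmul Q Q')⟩,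
    fun Q N => ⟨hmem N, hfN Q N _⟩⟩

/-- The properties of the orbit closure of `y M` and of the homomorphism induced by `y`, for `y`
one of the maps `x[·]` and `x₊[·]`. -/
theorem IsExpandingFunction.orbitClosure_properties (hb : 3 ≤ b) (hk : IsExpandingFunction b k)
    (hell : IsSupportMap ell) (hP : ∀ a, 0 < a → P a) {M : Label} (hM : M.IsFinitary)
    {y : Label → ℤ → Bool} (hy : y = pointOf k ell P) :
    (orbitClosure (y M)).Countable ∧ HasAbelianEnveloping ℤ (orbitClosure (y M)) ∧
      ActsContinuously ℤ (orbitClosure (y M)) ∧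
      ∃ J, (IsInduced y M J ∧ ∀ J', IsInduced y M J' → J' = J) ∧
        ∀ Q : envelopingSemigroup FIN M.Theta,
          ((J Q).1 (basePoint (y M)) : orbitClosure (y M)).1 = y (Q.1 M.toTheta : M.Theta).1 ∧
          ∀ q' : envelopingSemigroup ℤ (orbitClosure (y M)),
            (q'.1 (basePoint (y M)) : orbitClosure (y M)).1 = y (Q.1 M.toTheta : M.Theta).1 →
              q' = J Q := by
  subst hy
  have hab := hk.hasAbelianEnveloping_orbitClosure hb hell hP hM
  obtain ⟨J, hJ⟩ := hk.exists_isInduced hb hell hP hM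
  have huniq : ∀ (Q : envelopingSemigroup FIN M.Theta)
      (q' : envelopingSemigroup ℤ (orbitClosure (pointOf k ell P M))),
      (q'.1 (basePoint (pointOf k ell P M)) : orbitClosure (pointOf k ell P M)).1 =
        pointOf k ell P (Q.1 M.toTheta : M.Theta).1 → q' = J Q := fun Q q' h =>
    Subtype.ext (eq_of_apply_eq_of_dense (dense_orbit_basePoint _) hab q'.2 (J Q).2
      (Subtype.ext (h.trans (apply_basePoint_of_isInduced hJ Q).symm)))
  refine ⟨hk.countable_orbitClosure hb hM, hab,
    actsContinuously_of_dense (dense_orbit_basePoint _) hab, J, ⟨hJ, fun J' hJ' => ?_⟩,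
    fun Q => ⟨apply_basePoint_of_isInduced hJ Q, huniq Q⟩⟩
  exact MonoidHom.ext fun Q => huniq Q _ (apply_basePoint_of_isInduced hJ' Q)

theorem Label.IsExternalLimitSet.mem_Theta {M F : Label} (hF : M.IsExternalLimitSet F) :
    F ∈ M.Theta := by
  obtain ⟨r, -, -, h⟩ := hF
  exact mem_closure_of_tendsto h (Eventually.of_forall fun i => ⟨r i, rfl⟩)

end LabelShift


theorem theorem5 (b : ℕ) (hb : 3 ≤ b) (k : ℤ → ℤ) (hk : IsExpandingFunction b k)
    (hk1 : (b : ℤ) + 1 ≤ k 1) (ell : ℕ+ → ℕ+) (hell : IsSupportMap ell)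
    (M : Label) (hM : M.IsFinitary) :
    -- the two systems are countable WAP subshifts
    (IsSubshift (XOf k ell M) ∧ (XOf k ell M).Countable ∧ IsWAP (XOf k ell M)) ∧
    (IsSubshift (XPosOf k ell M) ∧ (XPosOf k ell M).Countable ∧ IsWAP (XPosOf k ell M)) ∧
    -- the induced homomorphisms, and the elements defined by external limit sets
    (∃ J : envelopingSemigroup FIN M.Theta →* envelopingSemigroup ℤ (XOf k ell M),
      ∃ JPos : envelopingSemigroup FIN M.Theta →* envelopingSemigroup ℤ (XPosOf k ell M),
        (IsInduced (xOf k ell) M J ∧ ∀ J', IsInduced (xOf k ell) M J' → J' = J) ∧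
        (IsInduced (xPosOf k ell) M JPos ∧ ∀ J', IsInduced (xPosOf k ell) M J' → J' = JPos) ∧
        ∀ F : Label, M.IsExternalLimitSet F →
          ∃ q : envelopingSemigroup ℤ (XOf k ell M),
          ∃ qPos : envelopingSemigroup ℤ (XPosOf k ell M),
          ∃ Q : envelopingSemigroup FIN M.Theta,
            ((q.1 (basePoint (xOf k ell M)) : XOf k ell M).1 = xOf k ell F ∧
              ∀ q' : envelopingSemigroup ℤ (XOf k ell M),
                (q'.1 (basePoint (xOf k ell M)) : XOf k ell M).1 = xOf k ell F → q' = q) ∧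
            ((qPos.1 (basePoint (xPosOf k ell M)) : XPosOf k ell M).1 = xPosOf k ell F ∧
              ∀ q' : envelopingSemigroup ℤ (XPosOf k ell M),
                (q'.1 (basePoint (xPosOf k ell M)) : XPosOf k ell M).1 = xPosOf k ell F → q' = qPos) ∧
            ((Q.1 M.toTheta : M.Theta).1 = F ∧
              ∀ Q' : envelopingSemigroup FIN M.Theta,
                (Q'.1 M.toTheta : M.Theta).1 = F → Q' = Q) ∧
            q = J Q ∧ qPos = JPos Q) ∧
    -- the three enveloping semigroups are abelian
    (HasAbelianEnveloping FIN M.Theta ∧ HasAbelianEnveloping ℤ (XOf k ell M) ∧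
      HasAbelianEnveloping ℤ (XPosOf k ell M)) ∧
    -- and their elements are continuous maps
    (ActsContinuously FIN M.Theta ∧ ActsContinuously ℤ (XOf k ell M) ∧
      ActsContinuously ℤ (XPosOf k ell M)) := by
  have hx : xOf k ell = pointOf k ell fun _ => True := by
    funext N
    rw [xOf, pointOf, timesOf_true]
  have hxPos : xPosOf k ell = pointOf k ell fun a => 0 < a := by
    funext N
    rw [xPosOf, pointOf, hk.timesOf_pos hb]
  obtain ⟨hc, hab, hact, J, hJ, hJQ⟩ :=
    hk.orbitClosure_properties hb hell (fun _ _ => trivial) hM hx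
  obtain ⟨hcPos, habPos, hactPos, JPos, hJPos, hJQPos⟩ :=
    hk.orbitClosure_properties hb hell (fun _ h => h) hM hxPos
  have hΘ := Label.hasAbelianEnveloping hM
  refine ⟨⟨isSubshift_orbitClosure _, hc, hact⟩, ⟨isSubshift_orbitClosure _, hcPos, hactPos⟩,
    ⟨J, JPos, hJ, hJPos, fun F hF => ?_⟩, ⟨hΘ, hab, habPos⟩,
    actsContinuously_of_dense M.dense_orbit hΘ, hact, hactPos⟩
  -- F is a point of Θ(M), hence the image of M under some Q; the elements of the two subshift
  -- semigroups are the images of this Q.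
  obtain ⟨Q, hQ, hQF⟩ := exists_apply_eq_of_dense M.dense_orbit ⟨F, hF.mem_Theta⟩
  have h1 := hJQ ⟨Q, hQ⟩
  have h2 := hJQPos ⟨Q, hQ⟩
  simp only [hQF] at h1 h2
  refine ⟨J ⟨Q, hQ⟩, JPos ⟨Q, hQ⟩, ⟨Q, hQ⟩, h1, h2, ⟨congrArg Subtype.val hQF, fun Q' h => ?_⟩,
    rfl, rfl⟩
  exact Subtype.ext (eq_of_apply_eq_of_dense M.dense_orbit hΘ Q'.2 hQ
    ((Subtype.ext h).trans hQF.symm))
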